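/- Let $G$ be a connected graph and let $U\subseteq V(G)$. Two assertions are called complementary if exactly one of them holds. Definitions. A *star attached to $U$* is a subdivided infinite star with all its leaves in $U$. A *comb* is the union of a ray (its spine) with infinitely many pairwise disjoint finite paths, possibly trivial, that have precisely their first vertex on the ray; the last vertices of these paths are its *teeth*. A star $S\subseteq G$ is *undominating* in $G$ if there is no comb $C\subseteq G$ such that infinitely many leaves of $S$ are teeth of $C$. The set $U$ is *tough* in $G$ if for every finite $X\subseteq V(G)$ only finitely many components of $G-X$ meet $U$. A finite set $X\subseteq V(G)$ is *critical* if infinitely many components of $G-X$ have neighbourhood precisely $X$, and a critical set $X$ *lies in the closure of $U$* if infinitely many of these components meet $U$. The ends of $G$ are the equivalence classes of rays of $G$, where two rays are equivalent if for every finite $X\subseteq V(G)$ they have tails in the same component of $G-X$; for an end $\omega$ this component is denoted by $C(X,\omega)$. An end $\omega$ *lies in the closure of $U$* if $C(X,\omega)$ meets $U$ for every finite $X\subseteq V(G)$, and $\partial_\Omega U$ is the set of these ends. On the set of all vertices and ends of $G$ consider the topology in which every vertex is isolated and every end $\omega$ has as a neighbourhood basis the sets consisting of the vertices of $C(X,\omega)$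 and the ends $\eta$ with $C(X,\eta)=C(X,\omega)$, for $X\subseteq V(G)$ finite. The set $U$ is *compactified by the ends of $G$ that lie in its closure* if the subspace $U\cup\partial_\Omega U$ is a compact Hausdorff space in which $U$ is dense. A rooted tree $T\subseteq G$ is *normal* in $G$ if the endvertices of every nontrivial path in $G$ that meets $T$ precisely in its endvertices are comparable in the tree-order of $T$ (where $x\le y$ if $x$ lies on the path in $T$ from the root to $y$). The tree $T$ *contains $U$ cofinally* if $U\subseteq V(T)$ and every vertex of $T$ lies below some element of $U$ in the tree-order. The set $U$ is *normally spanned* in $G$ if some normal tree $T\subseteq G$ contains $U$. Lemma 2.3. Each of the following assertions is complementary to the assertion that $G$ contains an undominating star attached to $U$: (i) $U$ is tough in $G$; (ii) $G$ has no critical vertex set that lies in the closure of $U$; (iii) $U$ is compactified by the ends of $G$ that lie in the closure of $U$. If $U$ is nonempty and normally spanned in $G$, then the following assertion is complementary to it as well: (iv) $G$ contains a locally finite normal tree that contains $U$ cofinally. -/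

import Mathlib

namespace StarComb

open SimpleGraph

universe u

variable {V : Type u}

/-! ### Components, tough vertex sets, critical vertex sets

For a vertex set `X` of `G`, Mathlib's `G.ComponentCompl X` is the set of components of `G - X`. -/

/-- A component `C` of `G - X` meets the vertex set `U`. -/
def Meets {G : SimpleGraph V} {X : Set V} (C : G.ComponentCompl X) (U : Set V) : Prop :=
  ((C : Set V) ∩ U).Nonempty

/-- The neighbourhood `N(W)` of a vertex set `W`: the vertices outside `W` with a neighbour
in `W`. -/
def neighbourhood (G : SimpleGraph V) (W : Set V) : Set V :=
  {v | v ∉ W ∧ ∃ w ∈ W, G.Adj v w}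

/-- `U` is tough in `G`: whenever finitely many vertices are deleted from `G`, only finitely many
components meet `U`. -/
def Tough (G : SimpleGraph V) (U : Set V) : Prop :=
  ∀ X : Finset V, {C : G.ComponentCompl (X : Set V) | Meets C U}.Finite

/-- The components of `G - X` whose neighbourhood is precisely `X`. -/
def fullComponents (G : SimpleGraph V) (X : Set V) : Set (G.ComponentCompl X) :=
  {C | neighbourhood G (C : Set V) = X}

/-- A finite vertex set `X` is critical if infinitely many components of `G - X` have their
neighbourhood precisely equal to `X`. -/
def IsCritical (G : SimpleGraph V) (X : Finset V) : Prop :=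
  (fullComponents G (X : Set V)).Infinite

/-- The critical vertex set `X` lies in the closure of `U`: infinitely many of the components
of `G - X` with neighbourhood precisely `X` meet `U`. -/
def CriticalInClosure (G : SimpleGraph V) (X : Finset V) (U : Set V) : Prop :=
  IsCritical G X ∧ {C ∈ fullComponents G (X : Set V) | Meets C U}.Infinite

/-! ### Rays, combs and subdivided stars -/

/-- A ray in `G`: a one-way infinite path. -/
structure Ray (G : SimpleGraph V) where
  vert : ℕ → V
  injective : Function.Injective vert
  adj : ∀ n, G.Adj (vert n) (vert (n + 1))

/-- A subdivided infinite star in `G`: a centre, an infinite set of leaves, and for every leaf a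
(nontrivial) path in `G` from the centre to that leaf, such that distinct paths meet only in the
centre. -/
structure SubdividedStar (G : SimpleGraph V) where
  centre : V
  leaves : Set V
  leaves_infinite : leaves.Infinite
  centre_notMem : centre ∉ leaves
  path : ∀ l : leaves, G.Path centre (l : V)
  meet : ∀ l m : leaves, l ≠ m → ∀ v, v ∈ (path l : G.Walk centre (l : V)).support →
    v ∈ (path m : G.Walk centre (m : V)).support → v = centre

/-- A comb in `G`: a ray (the spine) together with infinitely many pairwise disjoint finite paths,
possibly trivial, that have precisely their first vertex on the spine. The last vertices of these
paths are the teeth. The paths are disjoint, so they are indexed by their teeth. -/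
structure Comb (G : SimpleGraph V) where
  spine : Ray G
  teeth : Set V
  teeth_infinite : teeth.Infinite
  foot : teeth → V
  path : ∀ t : teeth, G.Path (foot t) (t : V)
  foot_mem : ∀ t, foot t ∈ Set.range spine.vert
  only_foot : ∀ t v, v ∈ (path t : G.Walk (foot t) (t : V)).support →
    v ∈ Set.range spine.vert → v = foot t
  disjoint : ∀ s t : teeth, s ≠ t → ∀ v, v ∈ (path s : G.Walk (foot s) (s : V)).support →
    v ∉ (path t : G.Walk (foot t) (t : V)).support

/-- A star dominates a comb if infinitely many of its leaves are also teeth of the comb. -/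
def SubdividedStar.Dominates {G : SimpleGraph V} (S : SubdividedStar G) (K : Comb G) : Prop :=
  (S.leaves ∩ K.teeth).Infinite

/-- A star in `G` is undominating in `G` if it dominates no comb in `G`. -/
def SubdividedStar.Undominating {G : SimpleGraph V} (S : SubdividedStar G) : Prop :=
  ¬ ∃ K : Comb G, S.Dominates K

/-- `G` contains an undominating star attached to `U`, i.e. one with all its leaves in `U`. -/
def HasUndominatingStar (G : SimpleGraph V) (U : Set V) : Prop :=
  ∃ S : SubdividedStar G, S.leaves ⊆ U ∧ S.Undominating

/-! ### Ends -/

/-- The ray `R` has a tail in the component `C` of `G - X`. -/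
def Ray.TailIn {G : SimpleGraph V} (R : Ray G) {X : Set V} (C : G.ComponentCompl X) : Prop :=
  ∃ N, ∀ n, N ≤ n → R.vert n ∈ C

theorem Ray.exists_tailIn {G : SimpleGraph V} (R : Ray G) (X : Finset V) :
    ∃ C : G.ComponentCompl (X : Set V), R.TailIn C := by
  have hfin : (R.vert ⁻¹' (X : Set V)).Finite := X.finite_toSet.preimage R.injective.injOn
  obtain ⟨M, hM⟩ := hfin.bddAbove
  have hout : ∀ n, M + 1 ≤ n → R.vert n ∉ (X : Set V) := by
    intro n hn hX
    have := hM (show n ∈ R.vert ⁻¹' (X : Set V) from hX)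
    omega
  refine ⟨G.componentComplMk (hout (M + 1) le_rfl), M + 1, fun n hn => ?_⟩
  induction n, hn using Nat.le_induction with
  | base => exact G.componentComplMk_mem _
  | succ n hn ih => exact ComponentCompl.mem_of_adj _ _ ih (hout _ (by omega)) (R.adj n)

theorem Ray.tailIn_unique {G : SimpleGraph V} (R : Ray G) {X : Set V} {C D : G.ComponentCompl X}
    (hC : R.TailIn C) (hD : R.TailIn D) : C = D := by
  obtain ⟨N, hN⟩ := hC
  obtain ⟨M, hM⟩ := hD
  obtain ⟨_, h₁⟩ := hN (max N M) (le_max_left _ _)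
  obtain ⟨_, h₂⟩ := hM (max N M) (le_max_right _ _)
  exact h₁.symm.trans h₂

/-- Two rays are equivalent if, for every finite vertex set `X`, they have a tail in the same
component of `G - X`. -/
instance raySetoid (G : SimpleGraph V) : Setoid (Ray G) where
  r R S := ∀ X : Finset V, ∃ C : G.ComponentCompl (X : Set V), R.TailIn C ∧ S.TailIn C
  iseqv :=
    { refl := fun R X => (R.exists_tailIn X).imp fun _ h => ⟨h, h⟩
      symm := fun h X => (h X).imp fun _ h => h.symm
      trans := by
        intro R S T h₁ h₂ X
        obtain ⟨C, hR, hS⟩ := h₁ X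
        obtain ⟨D, hS', hT⟩ := h₂ X
        exact ⟨C, hR, S.tailIn_unique hS hS' ▸ hT⟩ }

/-- The ends of `G`: the equivalence classes of rays. -/
def Ends (G : SimpleGraph V) : Type u := Quotient (raySetoid G)

/-- The component of `G - X` in which all rays of the end `ω` have a tail. -/
noncomputable def Ends.comp {G : SimpleGraph V} (ω : Ends G) (X : Finset V) :
    G.ComponentCompl (X : Set V) :=
  Quotient.lift (fun R : Ray G => (R.exists_tailIn X).choose) (by
    intro R S h
    obtain ⟨C, hR, hS⟩ := h X
    exact (R.tailIn_unique (R.exists_tailIn X).choose_spec hR).trans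
      (S.tailIn_unique hS (S.exists_tailIn X).choose_spec)) ω

theorem Ends.comp_spec {G : SimpleGraph V} (R : Ray G) (X : Finset V) :
    R.TailIn (Ends.comp (Quotient.mk (raySetoid G) R) X) :=
  (R.exists_tailIn X).choose_spec

theorem Ends.hom_comp {G : SimpleGraph V} (ω : Ends G) {X Y : Finset V} (h : X ⊆ Y) :
    (ω.comp Y).hom (Finset.coe_subset.2 h) = ω.comp X := by
  induction ω using Quotient.inductionOn with
  | h R =>
    refine R.tailIn_unique ?_ (Ends.comp_spec R X)
    obtain ⟨N, hN⟩ := Ends.comp_spec R Y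
    exact ⟨N, fun n hn => ComponentCompl.subset_hom _ (Finset.coe_subset.2 h) (hN n hn)⟩

/-- The ends of `G` that lie in the closure of `U`: the ends `ω` such that, for every finite `X`,
the component of `G - X` in which `ω` lives meets `U`. -/
def endsInClosure (G : SimpleGraph V) (U : Set V) : Set (Ends G) :=
  {ω | ∀ X : Finset V, Meets (ω.comp X) U}

/-! ### The space of vertices and ends -/

/-- The points of the space formed by the vertices and the ends of `G`. -/
inductive VertexEndSpace (G : SimpleGraph V) : Type u
  | vert : V → VertexEndSpace G
  | ofEnd : Ends G → VertexEndSpace G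

/-- The basic open neighbourhood of the end `ω` given by a finite vertex set `X`: all vertices of
the component of `G - X` in which `ω` lives, and all ends that live in this component. -/
def basicNhd {G : SimpleGraph V} (ω : Ends G) (X : Finset V) : Set (VertexEndSpace G) :=
  VertexEndSpace.vert '' (ω.comp X : Set V) ∪
    VertexEndSpace.ofEnd '' {η : Ends G | η.comp X = ω.comp X}

theorem basicNhd_anti {G : SimpleGraph V} (ω : Ends G) {X Y : Finset V} (h : X ⊆ Y) :
    basicNhd ω Y ⊆ basicNhd ω X := by
  rintro p (⟨v, hv, rfl⟩ | ⟨η, hη, rfl⟩)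
  · refine Or.inl ⟨v, ?_, rfl⟩
    rw [← ω.hom_comp h]
    exact ComponentCompl.subset_hom _ (Finset.coe_subset.2 h) hv
  · refine Or.inr ⟨η, ?_, rfl⟩
    change η.comp X = ω.comp X
    rw [← ω.hom_comp h, ← η.hom_comp h, (show η.comp Y = ω.comp Y from hη)]

/-- The usual topology on vertices and ends (the one that this set inherits from the standard
topologies on the graph together with its ends): vertices are isolated, and the sets
`basicNhd ω X` with `X` finite form a neighbourhood basis of the end `ω`. -/
instance vertexEndTopology (G : SimpleGraph V) : TopologicalSpace (VertexEndSpace G) where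
  IsOpen s := ∀ ω : Ends G, VertexEndSpace.ofEnd ω ∈ s → ∃ X : Finset V, basicNhd ω X ⊆ s
  isOpen_univ := fun _ _ => ⟨∅, Set.subset_univ _⟩
  isOpen_inter := by
    classical
    intro s t hs ht ω hω
    obtain ⟨X, hX⟩ := hs ω hω.1
    obtain ⟨Y, hY⟩ := ht ω hω.2
    exact ⟨X ∪ Y, Set.subset_inter ((basicNhd_anti ω Finset.subset_union_left).trans hX)
      ((basicNhd_anti ω Finset.subset_union_right).trans hY)⟩
  isOpen_sUnion := by
    intro S hS ω hω
    obtain ⟨s, hs, hωs⟩ := hω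
    obtain ⟨X, hX⟩ := hS s hs ω hωs
    exact ⟨X, hX.trans (Set.subset_sUnion_of_mem hs)⟩

/-- The set `U` together with the ends of `G` in its closure. -/
def withEnds (G : SimpleGraph V) (U : Set V) : Set (VertexEndSpace G) :=
  VertexEndSpace.vert '' U ∪ VertexEndSpace.ofEnd '' endsInClosure G U

/-- `U` is compactified by the ends of `G` in its closure: adding these ends to `U` yields a
compact Hausdorff space in which `U` is dense. -/
def CompactifiedByEnds (G : SimpleGraph V) (U : Set V) : Prop :=
  IsCompact (withEnds G U) ∧ T2Space (withEnds G U) ∧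
    withEnds G U ⊆ closure (VertexEndSpace.vert '' U)

/-! ### Normal trees -/

/-- A rooted tree `T ⊆ G`. -/
structure RootedTree (G : SimpleGraph V) where
  T : G.Subgraph
  isTree : T.coe.IsTree
  root : T.verts

/-- The tree-order of a rooted tree: `x ≤ y` if `x` lies on the (unique) path in `T` from the root
to `y`. -/
def RootedTree.le {G : SimpleGraph V} (T : RootedTree G) (x y : T.T.verts) : Prop :=
  ∃ p : T.T.coe.Path T.root y, x ∈ (p : T.T.coe.Walk T.root y).support

/-- `T` is normal in `G`: the endvertices of every `T`-path in `G` (a nontrivial path meeting `T`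
precisely in its endvertices) are comparable in the tree-order. -/
def RootedTree.IsNormal {G : SimpleGraph V} (T : RootedTree G) : Prop :=
  ∀ x y : T.T.verts, x ≠ y → ∀ p : G.Path (x : V) (y : V),
    (∀ v ∈ (p : G.Walk (x : V) (y : V)).support, v ∈ T.T.verts → v = x ∨ v = y) →
    T.le x y ∨ T.le y x

/-- Every vertex of `T` has finite degree in `T`. -/
def RootedTree.IsLocallyFinite {G : SimpleGraph V} (T : RootedTree G) : Prop :=
  ∀ v ∈ T.T.verts, (T.T.neighborSet v).Finite

/-- `T` contains `U` cofinally: `U ⊆ V(T)` and every vertex of `T` lies below some element of `U`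
in the tree-order. -/
def RootedTree.ContainsCofinally {G : SimpleGraph V} (T : RootedTree G) (U : Set V) : Prop :=
  U ⊆ T.T.verts ∧ ∀ x : T.T.verts, ∃ y : T.T.verts, (y : V) ∈ U ∧ T.le x y

/-- `U` is normally spanned in `G`: some normal tree `T ⊆ G` contains `U`. -/
def NormallySpanned (G : SimpleGraph V) (U : Set V) : Prop :=
  ∃ T : RootedTree G, T.IsNormal ∧ U ⊆ T.T.verts

end StarComb

/-!
Toughness of `U` is the hub of the argument: the other assertions are equivalent to it, and it is
complementary to the existence of an undominating star attached to `U`.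

If `U` is not tough, then infinitely many components of some `G - X` meet `U`. By the pigeonhole
principle infinitely many of them have the same neighbourhood `Y ⊆ X`, and `Y` is a critical set in
the closure of `U` (`exists_criticalInClosure`). Paths from a fixed vertex of `Y` through these
components to `U` form a star; it is undominating because the spine of a comb has a tail in just one
component of `G - Y`, and all but finitely many teeth lie in that component
(`CriticalInClosure.hasUndominatingStar`).

Conversely, suppose that `U` is tough. For every finite `X`, a nonprincipal ultrafilter on `U`
concentrates on one of the finitely many components of `G - X` that meet `U`; so it determines a
direction, that is, a coherent choice of one component of `G - X` for every finite `X`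
(`Tough.exists_direction`). This has two uses. First, a direction whose components all meet a set
`A` yields a comb with all its teeth in `A` (`Direction.exists_comb`); with `A` the set of leaves of
a star attached to `U`, this shows that no such star is undominating. Second, every direction is
induced by an end (`Direction.exists_end`, a theorem of Diestel and Kühn), to which the ultrafilter
then converges; hence `U` with the ends in its closure is compact. The Hausdorff property and the
density of `U` hold for every `U`, and that compactness implies toughness is seen from a cover by
the components of `G - X`.

For normal trees, the point is that two vertices of a normal tree are separated in `G` by the
vertices below both of them (`RootedTree.IsNormal.exists_le_mem_support`). Hence the down-closure of
`U` in a normal tree is again normal, and if one of its vertices `v` had infinitely many children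
there, then deleting the finitely many vertices below `v` would leave infinitely many components
meeting `U`. Conversely, every subset of a locally finite tree in `G` is tough.
-/

namespace StarComb

open SimpleGraph

universe u

variable {V : Type u} {G : SimpleGraph V}

/-! ### Walks and components -/

/-- A walk that starts in a component of `G - X` and avoids `X` stays in that component. -/
theorem mem_component_of_walk {X : Set V} {C : G.ComponentCompl X} {a b : V} (w : G.Walk a b)
    (ha : a ∈ C) (hw : ∀ v ∈ w.support, v ∉ X) : ∀ v ∈ w.support, v ∈ C := by
  induction w with
  | nil => simpa using ha
  | cons h p ih =>
    intro v hv
    rcases List.mem_cons.1 (by simpa using hv) with rfl | hv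
    · exact ha
    · refine ih ?_ (fun v hv => hw v (by simp [hv])) v hv
      exact ComponentCompl.mem_of_adj _ _ ha (hw _ (by simp)) h

theorem exists_walk_in_component {X : Set V} {C : G.ComponentCompl X} {a b : V} (ha : a ∈ C)
    (hb : b ∈ C) : ∃ w : G.Walk a b, w.IsPath ∧ ∀ v ∈ w.support, v ∈ C := by
  classical
  obtain ⟨haX, rfl⟩ := ha
  obtain ⟨hbX, hab⟩ := hb
  obtain ⟨w⟩ := ConnectedComponent.exact hab.symm
  let φ : G.induce Xᶜ →g G := ⟨Subtype.val, fun h => h⟩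
  refine ⟨_, (w.map φ).bypass_isPath, fun v hv => ?_⟩
  have hv := Walk.support_bypass_subset_support _ hv
  refine mem_component_of_walk _ (G.componentComplMk_mem haX) ?_ v hv
  intro v hv
  rw [Walk.support_map, List.mem_map] at hv
  obtain ⟨z, -, rfl⟩ := hv
  exact z.2

theorem component_eq_of_mem {X : Set V} {C D : G.ComponentCompl X} {v : V} (hC : v ∈ C)
    (hD : v ∈ D) : C = D :=
  hC.choose_spec.symm.trans hD.choose_spec

/-! ### Rays from chains of paths -/

/-- The walk obtained by concatenating the first `n` members of a chain of walks. -/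
def chainWalk {r : ℕ → V} (Q : ∀ n, G.Walk (r n) (r (n + 1))) : ∀ n, G.Walk (r 0) (r n)
  | 0 => Walk.nil
  | n + 1 => (chainWalk Q n).append (Q n)

theorem getVert_chainWalk {r : ℕ → V} (Q : ∀ n, G.Walk (r n) (r (n + 1))) {n m k : ℕ}
    (hnm : n ≤ m) (hk : k ≤ (chainWalk Q n).length) :
    k ≤ (chainWalk Q m).length ∧ (chainWalk Q m).getVert k = (chainWalk Q n).getVert k := by
  induction m, hnm using Nat.le_induction with
  | base => exact ⟨hk, rfl⟩
  | succ m _ ih =>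
    refine ⟨by simp only [chainWalk, Walk.length_append]; omega, ?_⟩
    rw [← ih.2, chainWalk, Walk.getVert_append]
    split_ifs with h
    · rfl
    · have : k = (chainWalk Q m).length := by omega
      subst this
      simp

theorem mem_support_chainWalk {r : ℕ → V} (Q : ∀ n, G.Walk (r n) (r (n + 1))) {n : ℕ} {v : V}
    (h : v ∈ (chainWalk Q n).support) : v = r 0 ∨ ∃ m < n, v ∈ (Q m).support := by
  induction n with
  | zero => left; simpa [chainWalk] using h
  | succ n ih =>
    rw [chainWalk, Walk.mem_support_append_iff] at h
    rcases h with h | h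
    · exact (ih h).imp_right fun ⟨m, hm, h⟩ => ⟨m, by omega, h⟩
    · exact Or.inr ⟨n, by omega, h⟩

/-- If all initial concatenations of a chain of nontrivial walks are paths, their union is a
ray. -/
theorem exists_ray_of_chain {r : ℕ → V} (Q : ∀ n, G.Walk (r n) (r (n + 1)))
    (hQ : ∀ n, 0 < (Q n).length) (hpath : ∀ n, (chainWalk Q n).IsPath) :
    ∃ R : Ray G, ∀ v, v ∈ Set.range R.vert ↔ ∃ n, v ∈ (Q n).support := by
  have hlen : ∀ n, n ≤ (chainWalk Q n).length := by
    intro n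
    induction n with
    | zero => simp
    | succ n ih =>
      have := hQ n
      simp only [chainWalk, Walk.length_append]
      omega
  have key : ∀ {k n}, k ≤ n → (chainWalk Q n).getVert k = (chainWalk Q k).getVert k :=
    fun h => (getVert_chainWalk Q h (hlen _)).2
  refine ⟨⟨fun k => (chainWalk Q k).getVert k, fun i j hij => ?_, fun n => ?_⟩, fun v => ?_⟩
  · dsimp only at hij
    rw [← key (le_max_left i j), ← key (le_max_right i j)] at hij
    exact (hpath (max i j)).getVert_injOn ((le_max_left i j).trans (hlen _))
      ((le_max_right i j).trans (hlen _)) hij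
  · rw [← key (Nat.le_succ n)]
    exact Walk.adj_getVert_succ _ (hlen (n + 1))
  · constructor
    · rintro ⟨k, rfl⟩
      rcases mem_support_chainWalk Q ((chainWalk Q k).getVert_mem_support k) with h | ⟨m, -, h⟩
      · refine ⟨0, ?_⟩
        change (chainWalk Q k).getVert k ∈ _
        rw [h]
        exact (Q 0).start_mem_support
      · exact ⟨m, h⟩
    · rintro ⟨n, hn⟩
      have : v ∈ (chainWalk Q (n + 1)).support := by
        rw [chainWalk, Walk.mem_support_append_iff]
        exact Or.inr hn
      obtain ⟨k, rfl, hk⟩ := Walk.mem_support_iff_exists_getVert.1 this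
      refine ⟨k, ?_⟩
      rcases le_total k (n + 1) with h | h
      · exact (key h).symm
      · exact (getVert_chainWalk Q h hk).2

theorem isPath_append {a b c : V} {p : G.Walk a b} {q : G.Walk b c} (hp : p.IsPath)
    (hq : q.IsPath) (h : ∀ v ∈ p.support, v ∈ q.support → v = b) : (p.append q).IsPath := by
  rw [Walk.isPath_def, Walk.support_append, List.nodup_append']
  refine ⟨hp.support_nodup, hq.support_nodup.tail, fun v hv hv' => ?_⟩
  obtain rfl := h v hv (List.mem_of_mem_tail hv')
  have := hq.support_nodup
  rw [← Walk.cons_tail_support] at this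
  exact (List.nodup_cons.1 this).1 hv'

theorem eq_of_mem_of_isPath_append {a b c : V} {p : G.Walk a b} {q : G.Walk b c}
    (h : (p.append q).IsPath) {v : V} (hp : v ∈ p.support) (hq : v ∈ q.support) : v = b := by
  rw [Walk.isPath_def, Walk.support_append, List.nodup_append'] at h
  rw [← Walk.cons_tail_support] at hq
  rcases List.mem_cons.1 hq with rfl | hq
  · rfl
  · exact (h.2.2 hp hq).elim

/-! ### Directions -/

/-- A direction of `G`: a coherent choice of a component of `G - X` for every finite vertex
set `X`. -/
structure Direction (G : SimpleGraph V) where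
  comp : ∀ X : Finset V, G.ComponentCompl (X : Set V)
  anti : ∀ ⦃X Y : Finset V⦄, X ⊆ Y → ∀ ⦃v⦄, v ∈ comp Y → v ∈ comp X

theorem Direction.exists_mem (f : Direction G) (X : Finset V) : ∃ v, v ∈ f.comp X :=
  (f.comp X).nonempty

/-- The step in the construction of a comb along a direction: the path `P` from `r` to `p`, and
then the edge from `p` to `r'`, continue the spine, while `T` is the tooth-path that starts
in `p`. -/
theorem Direction.exists_step [DecidableEq V] (f : Direction G) {A : Set V}
    (hA : ∀ X, Meets (f.comp X) A) (X : Finset V) (r : V) (hr : r ∈ f.comp X) :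
    ∃ (t p r' : V) (P : G.Walk r p) (T : G.Walk p t), t ∈ A ∧ (P.append T).IsPath ∧
      (∀ v ∈ (P.append T).support, v ∈ f.comp X) ∧ G.Adj p r' ∧
      r' ∈ f.comp (X ∪ (P.append T).support.toFinset) := by
  obtain ⟨t, htX, htA⟩ := hA X
  obtain ⟨W, hW, hWX⟩ := exists_walk_in_component hr htX
  obtain ⟨b, hb⟩ := f.exists_mem (X ∪ W.support.toFinset)
  obtain ⟨B, -, hB⟩ := exists_walk_in_component hr (f.anti Finset.subset_union_left hb)
  obtain ⟨d, hd, hd₁, hd₂⟩ := B.exists_boundary_dart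
    {v | v ∉ f.comp (X ∪ W.support.toFinset)}
    (fun h => ComponentCompl.notMem_of_mem h (by simp)) (not_not.2 hb)
  have hd₂ : d.snd ∈ f.comp (X ∪ W.support.toFinset) := not_not.1 hd₂
  have hpW : d.fst ∈ W.support := by
    by_contra hnot
    refine hd₁ (ComponentCompl.mem_of_adj _ _ hd₂ ?_ d.adj.symm)
    have := ComponentCompl.notMem_of_mem (hB _ (B.dart_fst_mem_support_of_mem_darts hd))
    simp only [Finset.coe_union, List.coe_toFinset, Set.mem_union, Set.mem_ofPred_eq, not_or]
    exact ⟨this, hnot⟩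
  refine ⟨t, d.fst, d.snd, W.takeUntil _ hpW, W.dropUntil _ hpW, htA, ?_, ?_, d.adj, ?_⟩ <;>
    rw [Walk.take_spec]
  exacts [hW, hWX, hd₂]

/-- If `A` meets all components chosen by a direction, then there is a comb with all its teeth in
`A`. The spine and the teeth-paths are found simultaneously: in the current component take a path
from the current vertex to `A`, delete it, and leave it for the next component; the part of the
path behind the point of departure becomes a tooth-path. -/
theorem Direction.exists_comb (f : Direction G) {A : Set V} (hA : ∀ X, Meets (f.comp X) A) :
    ∃ K : Comb G, K.teeth ⊆ A := by
  classical
  choose t p r' P T htA hPT hPTX hadj hr' using f.exists_step hA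
  -- A state consists of the set deleted so far and the current vertex.
  obtain ⟨r₀, hr₀⟩ := f.exists_mem ∅
  let next : {s : Finset V × V // s.2 ∈ f.comp s.1} → {s : Finset V × V // s.2 ∈ f.comp s.1} :=
    fun s => ⟨(_, _), hr' s.1.1 s.1.2 s.2⟩
  let s : ℕ → {s : Finset V × V // s.2 ∈ f.comp s.1} := fun n => next^[n] ⟨(∅, r₀), hr₀⟩
  have hs : ∀ n, s (n + 1) = next (s n) := fun n => Function.iterate_succ_apply' _ _ _
  let X : ℕ → Finset V := fun n => (s n).1.1
  let r : ℕ → V := fun n => (s n).1.2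
  have hr : ∀ n, r n ∈ f.comp (X n) := fun n => (s n).2
  let tt : ℕ → V := fun n => t (X n) (r n) (hr n)
  let pp : ℕ → V := fun n => p (X n) (r n) (hr n)
  let PP : ∀ n, G.Walk (r n) (pp n) := fun n => P (X n) (r n) (hr n)
  let TT : ∀ n, G.Walk (pp n) (tt n) := fun n => T (X n) (r n) (hr n)
  have hPT : ∀ n, ((PP n).append (TT n)).IsPath := fun n => hPT _ _ _
  have hPTX : ∀ n, ∀ v ∈ ((PP n).append (TT n)).support, v ∈ f.comp (X n) :=
    fun n => hPTX _ _ _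
  have hX : ∀ n, X (n + 1) = X n ∪ ((PP n).append (TT n)).support.toFinset := fun n => by
    change (s (n + 1)).1.1 = _
    rw [hs]
  have hadj : ∀ n, G.Adj (pp n) (r (n + 1)) := fun n => by
    change G.Adj _ (s (n + 1)).1.2
    rw [hs]
    exact hadj _ _ _
  have hXmono : Monotone X := monotone_nat_of_le_succ fun n => by
    rw [hX]; exact Finset.subset_union_left
  have hsub : ∀ {m n}, m < n → ∀ v ∈ ((PP m).append (TT m)).support, v ∈ X n := by
    intro m n hmn v hv
    apply hXmono hmn
    rw [Nat.succ_eq_add_one, hX]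
    exact Finset.mem_union_right _ (by simpa using hv)
  have hdisj : ∀ {m n v}, v ∈ ((PP m).append (TT m)).support →
      v ∈ ((PP n).append (TT n)).support → m = n := by
    intro m n v hm hn
    rcases lt_trichotomy m n with h | h | h
    · exact (ComponentCompl.notMem_of_mem (hPTX n v hn) (hsub h v hm)).elim
    · exact h
    · exact (ComponentCompl.notMem_of_mem (hPTX m v hm) (hsub h v hn)).elim
  have hP : ∀ {n v}, v ∈ (PP n).support → v ∈ ((PP n).append (TT n)).support := fun h =>
    (Walk.mem_support_append_iff _ _).2 (Or.inl h)
  have hT : ∀ {n v}, v ∈ (TT n).support → v ∈ ((PP n).append (TT n)).support := fun h =>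
    (Walk.mem_support_append_iff _ _).2 (Or.inr h)
  let Q : ∀ n, G.Walk (r n) (r (n + 1)) := fun n => (PP n).concat (hadj n)
  have hQ : ∀ {n v}, v ∈ (Q n).support ↔ v ∈ (PP n).support ∨ v = r (n + 1) := by
    intro n v
    simp [Q, Walk.support_concat]
  have hpath : ∀ n, (chainWalk Q n).IsPath := by
    intro n
    induction n with
    | zero => exact Walk.IsPath.nil
    | succ n ih =>
      refine isPath_append ih ((hPT n).of_append_left.concat (fun h => ?_) _) fun v hv hv' => ?_
      · exact ComponentCompl.notMem_of_mem (hr (n + 1)) (hsub (Nat.lt_succ_self n) _ (hP h))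
      · by_contra hne
        have hv : ∃ m < n, v ∈ (PP m).support := by
          rcases mem_support_chainWalk Q hv with rfl | ⟨m, hm, hv⟩
          · have : n ≠ 0 := by rintro rfl; exact hne rfl
            exact ⟨0, by omega, (PP 0).start_mem_support⟩
          · rcases hQ.1 hv with hv | rfl
            · exact ⟨m, hm, hv⟩
            · have : m + 1 ≠ n := by rintro rfl; exact hne rfl
              exact ⟨m + 1, by omega, (PP (m + 1)).start_mem_support⟩
        obtain ⟨m, hm, hv⟩ := hv
        rcases hQ.1 hv' with h | rfl
        · exact hm.ne (hdisj (hP hv) (hP h))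
        · exact ComponentCompl.notMem_of_mem (hr (n + 1)) (hsub (by omega) _ (hP hv))
  obtain ⟨R, hR⟩ := exists_ray_of_chain Q (fun n => by simp [Q]) hpath
  have hR : ∀ v, v ∈ Set.range R.vert ↔ ∃ n, v ∈ (PP n).support := by
    intro v
    rw [hR]
    constructor
    · rintro ⟨n, hn⟩
      rcases hQ.1 hn with h | rfl
      · exact ⟨n, h⟩
      · exact ⟨n + 1, (PP (n + 1)).start_mem_support⟩
    · rintro ⟨n, hn⟩
      exact ⟨n, hQ.2 (Or.inl hn)⟩
  have htinj : Function.Injective tt := fun m n h => by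
    refine hdisj (hT (TT m).end_mem_support) (hT ?_)
    rw [h]
    exact (TT n).end_mem_support
  -- The paths of a comb are indexed by their teeth rather than by `ℕ`.
  let idx : Set.range tt → ℕ := fun t => t.2.choose
  have hidx : ∀ t, tt (idx t) = t := fun t => t.2.choose_spec
  refine ⟨{
    spine := R
    teeth := Set.range tt
    teeth_infinite := Set.infinite_range_of_injective htinj
    foot := fun t => pp (idx t)
    path := fun t => ⟨(TT (idx t)).copy rfl (hidx t), by simpa using (hPT _).of_append_right⟩
    foot_mem := fun t => (hR _).2 ⟨idx t, (PP _).end_mem_support⟩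
    only_foot := ?_
    disjoint := ?_ }, ?_⟩
  · intro t v hv hvR
    simp only [Walk.support_copy] at hv
    obtain ⟨m, hm⟩ := (hR v).1 hvR
    obtain rfl := hdisj (hP hm) (hT hv)
    exact eq_of_mem_of_isPath_append (hPT _) hm hv
  · intro t t' htt' v hv hv'
    simp only [Walk.support_copy] at hv hv'
    exact htt' (Subtype.ext (by rw [← hidx t, ← hidx t', hdisj (hT hv) (hT hv')]))
  · rintro _ ⟨n, rfl⟩
    exact htA _ _ _

/-! ### Ends and directions -/

/-- Only finitely many of the disjoint tooth-paths of a comb meet a given finite set. -/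
theorem Comb.finite_teeth_meeting (K : Comb G) (X : Finset V) :
    {t : K.teeth | ∃ v ∈ (K.path t : G.Walk (K.foot t) (t : V)).support, v ∈ X}.Finite := by
  choose g hg hgX using fun t : {t : K.teeth | ∃ v ∈
    (K.path t : G.Walk (K.foot t) (t : V)).support, v ∈ X} => t.2
  refine Finite.of_injective (fun t => (⟨g t, hgX t⟩ : X)) fun s t hst => ?_
  by_contra hne
  refine K.disjoint s t (fun h => hne (Subtype.ext h)) _ (hg s) ?_
  rw [show g s = g t from congrArg Subtype.val hst]
  exact hg t

theorem Comb.foot_injective (K : Comb G) : Function.Injective K.foot := by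
  intro s t hst
  by_contra hne
  refine K.disjoint s t hne (K.foot s) (Walk.start_mem_support _) ?_
  rw [hst]
  exact Walk.start_mem_support _

/-- All but finitely many teeth of a comb lie in the component in which its spine has a tail. -/
theorem Comb.finite_teeth_notMem (K : Comb G) {X : Finset V} {C : G.ComponentCompl (X : Set V)}
    (hC : K.spine.TailIn C) : (K.teeth \ C).Finite := by
  obtain ⟨N, hN⟩ := hC
  have h₁ : {t : K.teeth | K.foot t ∈ K.spine.vert '' Set.Iio N}.Finite :=
    ((Set.finite_Iio N).image _).preimage K.foot_injective.injOn
  refine ((h₁.union (K.finite_teeth_meeting X)).image Subtype.val).subset ?_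
  rintro t ⟨ht, htC⟩
  refine ⟨⟨t, ht⟩, ?_, rfl⟩
  by_contra hnot
  simp only [Set.mem_union, Set.mem_ofPred_eq, not_or, not_exists, not_and] at hnot
  obtain ⟨n, hn⟩ := K.foot_mem ⟨t, ht⟩
  have hNn : N ≤ n := by
    by_contra hlt
    exact hnot.1 ⟨n, by simpa using hlt, hn⟩
  have := hN n hNn
  rw [hn] at this
  exact htC (mem_component_of_walk _ this hnot.2 t (Walk.end_mem_support _))

/-- A direction is induced by an end as soon as some vertex set meets all its components and lies
almost entirely in each of them. -/
theorem Direction.exists_end_of_almost (f : Direction G) {A : Set V}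
    (hA : ∀ X, Meets (f.comp X) A) (hfin : ∀ X, (A \ f.comp X).Finite) :
    ∃ ω : Ends G, ∀ X, ω.comp X = f.comp X := by
  obtain ⟨K, hK⟩ := f.exists_comb hA
  refine ⟨Quotient.mk (raySetoid G) K.spine, fun X => ?_⟩
  have h := (K.finite_teeth_notMem (Ends.comp_spec K.spine X)).union
    ((hfin X).subset (Set.sdiff_subset_sdiff_left hK))
  obtain ⟨t, ht, hnot⟩ := K.teeth_infinite.exists_notMem_finite h
  simp only [Set.mem_union, Set.mem_sdiff, ht, true_and, not_or, not_not] at hnot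
  exact component_eq_of_mem hnot.1 hnot.2

/-- If the components that a direction chooses for an increasing sequence of finite sets have empty
intersection, then the direction is induced by an end. -/
theorem Direction.exists_end_of_iInter (f : Direction G) (Z : ℕ → Finset V) (hZ : Monotone Z)
    (hemp : ∀ y, ∃ n, y ∉ f.comp (Z n)) : ∃ ω : Ends G, ∀ X, ω.comp X = f.comp X := by
  classical
  -- Every component chosen by `f` contains one of those in the sequence.
  have key : ∀ Y : Finset V, ∃ n, ∀ z, z ∈ f.comp (Z n) → z ∈ f.comp Y := by
    intro Y
    choose N hN using hemp
    refine ⟨Y.sup N, fun z hz => ?_⟩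
    obtain ⟨c, hc⟩ := f.exists_mem (Z (Y.sup N) ∪ Y)
    obtain ⟨w, -, hw⟩ := exists_walk_in_component (f.anti Finset.subset_union_left hc) hz
    refine mem_component_of_walk w (f.anti Finset.subset_union_right hc) (fun v hv hvY => ?_) z
      w.end_mem_support
    exact hN v (f.anti (hZ (Finset.le_sup hvY)) (hw v hv))
  choose b hb using fun n => f.exists_mem (Z n)
  refine f.exists_end_of_almost (A := Set.range b) (fun X => ?_) fun X => ?_
  · obtain ⟨n, hn⟩ := key X
    exact ⟨b n, hn _ (hb n), n, rfl⟩
  · obtain ⟨n, hn⟩ := key X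
    refine ((Set.finite_Iio n).image b).subset ?_
    rintro _ ⟨⟨m, rfl⟩, hm⟩
    refine ⟨m, ?_, rfl⟩
    by_contra hle
    exact hm (hn _ (f.anti (hZ (not_lt.1 hle)) (hb m)))

/-- Every direction is induced by an end. Let `D` be the set of vertices that no finite set
separates from the direction. If `D` meets all its components, then `D` itself is a set as in
`Direction.exists_end_of_almost`. Otherwise we choose finite sets whose boundaries towards the
direction are disjoint layers; a finite path can cross only finitely many layers, so the
components shrink to nothing. -/
theorem Direction.exists_end (f : Direction G) : ∃ ω : Ends G, ∀ X, ω.comp X = f.comp X := by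
  classical
  by_cases hD : ∀ X, Meets (f.comp X) {v | ∀ Y : Finset V, v ∉ Y → v ∈ f.comp Y}
  · refine f.exists_end_of_almost hD fun X => X.finite_toSet.subset ?_
    rintro v ⟨hv, hvX⟩
    by_contra hnot
    exact hvX (hv X hnot)
  obtain ⟨X₀, hX₀⟩ := not_forall.1 hD
  have hsep : ∀ v, v ∈ f.comp X₀ → ∃ Y : Finset V, v ∉ Y ∧ v ∉ f.comp Y := by
    intro v hv
    by_contra! hnot
    exact hX₀ ⟨v, hv, hnot⟩
  choose! S hS₁ hS₂ using hsep
  obtain ⟨s, hs⟩ := f.exists_mem X₀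
  let Z : ℕ → Finset V := fun n =>
    (fun Z : Finset V => Z ∪ (Z.filter (· ∈ f.comp X₀)).biUnion S)^[n] (insert s X₀)
  have hZs : ∀ n, Z (n + 1) = Z n ∪ ((Z n).filter (· ∈ f.comp X₀)).biUnion S := fun n =>
    Function.iterate_succ_apply' _ _ _
  have hZ : Monotone Z := monotone_nat_of_le_succ fun n => by
    rw [hZs]; exact Finset.subset_union_left
  refine f.exists_end_of_iInter Z hZ fun y => ?_
  by_contra! hy
  have hy₀ : y ∈ f.comp X₀ := f.anti (Finset.subset_insert s X₀) (hy 0)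
  obtain ⟨w, -, hw⟩ := exists_walk_in_component hy₀ hs
  -- The path `w` leaves `f.comp (Z n)` through a vertex of `Z n` that lies in no earlier `Z m`.
  have hcross : ∀ n, ∃ b ∈ w.support, b ∈ Z n ∧ ∀ m < n, b ∉ Z m := by
    intro n
    have hsn : s ∉ f.comp (Z n) := fun h =>
      ComponentCompl.notMem_of_mem h (hZ (Nat.zero_le n) (Finset.mem_insert_self s X₀))
    obtain ⟨d, hd, hd₁, hd₂⟩ := w.exists_boundary_dart (f.comp (Z n)) (hy n) hsn
    have hdw := w.dart_snd_mem_support_of_mem_darts hd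
    refine ⟨d.snd, hdw, ?_, fun m hm hmem => ?_⟩
    · by_contra hnot
      exact hd₂ (ComponentCompl.mem_of_adj _ _ hd₁ hnot d.adj)
    · have hsub : S d.snd ⊆ Z n := by
        refine subset_trans ?_ (hZ hm)
        rw [Nat.succ_eq_add_one, hZs]
        refine subset_trans ?_ Finset.subset_union_right
        exact Finset.subset_biUnion_of_mem S (Finset.mem_filter.2 ⟨hmem, hw _ hdw⟩)
      exact hS₂ _ (hw _ hdw)
        (ComponentCompl.mem_of_adj _ _ (f.anti hsub hd₁) (hS₁ _ (hw _ hdw)) d.adj)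
  choose b hb₁ hb₂ hb₃ using hcross
  have hinj : Function.Injective b := by
    intro m n hmn
    rcases lt_trichotomy m n with h | h | h
    · exact (hb₃ n m h (hmn ▸ hb₂ m)).elim
    · exact h
    · exact (hb₃ m n h (hmn ▸ hb₂ n)).elim
  exact Set.infinite_range_of_injective hinj
    (w.support.toFinset.finite_toSet.subset (by rintro _ ⟨n, rfl⟩; simpa using hb₁ n))

/-! ### Tough sets and compactness -/

theorem Tough.subset {U L : Set V} (hU : Tough G U) (h : L ⊆ U) : Tough G L := fun X =>
  (hU X).subset fun _ hC => hC.mono (Set.inter_subset_inter_right _ h)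

/-- The set of all vertices and ends in a component of `G - X`. -/
def componentBox {X : Finset V} (C : G.ComponentCompl (X : Set V)) : Set (VertexEndSpace G) :=
  VertexEndSpace.vert '' (C : Set V) ∪ VertexEndSpace.ofEnd '' {η : Ends G | η.comp X = C}

theorem vert_mem_componentBox {X : Finset V} {C : G.ComponentCompl (X : Set V)} {v : V} :
    VertexEndSpace.vert v ∈ componentBox C ↔ v ∈ C := by
  simp [componentBox, -ComponentCompl.mem_supp_iff]

theorem ofEnd_mem_componentBox {X : Finset V} {C : G.ComponentCompl (X : Set V)} {ω : Ends G} :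
    VertexEndSpace.ofEnd ω ∈ componentBox C ↔ ω.comp X = C := by
  simp [componentBox]

theorem isOpen_componentBox {X : Finset V} (C : G.ComponentCompl (X : Set V)) :
    IsOpen (componentBox C) := by
  intro ω hω
  refine ⟨X, ?_⟩
  rw [← ofEnd_mem_componentBox.1 hω]
  exact subset_rfl

theorem isOpen_singleton_vert (v : V) :
    IsOpen ({VertexEndSpace.vert v} : Set (VertexEndSpace G)) := by
  intro ω hω
  cases hω

theorem exists_mem_componentBox {U : Set V} {p : VertexEndSpace G} (hp : p ∈ withEnds G U)
    (X : Finset V) : (∃ x ∈ X, p = VertexEndSpace.vert x) ∨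
      ∃ C : G.ComponentCompl (X : Set V), Meets C U ∧ p ∈ componentBox C := by
  rcases hp with ⟨v, hv, rfl⟩ | ⟨ω, hω, rfl⟩
  · by_cases hvX : v ∈ X
    · exact Or.inl ⟨v, hvX, rfl⟩
    · have hvX : v ∉ (X : Set V) := hvX
      exact Or.inr ⟨G.componentComplMk hvX, ⟨v, G.componentComplMk_mem hvX, hv⟩,
        vert_mem_componentBox.2 (G.componentComplMk_mem hvX)⟩
  · exact Or.inr ⟨ω.comp X, hω X, ofEnd_mem_componentBox.2 rfl⟩

/-- If `U` is tough, then for every finite `X` a nonprincipal ultrafilter on `U` and its ends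
concentrates on one component of `G - X`, and so it determines a direction. -/
theorem Tough.exists_direction {U : Set V} (hU : Tough G U) (F : Ultrafilter (VertexEndSpace G))
    (hF : withEnds G U ∈ F) (hne : ∀ v, {VertexEndSpace.vert v} ∉ F) :
    ∃ f : Direction G, ∀ X, componentBox (f.comp X) ∈ F ∧ Meets (f.comp X) U := by
  have h : ∀ X : Finset V, ∃ C : G.ComponentCompl (X : Set V), componentBox C ∈ F ∧ Meets C U := by
    intro X
    have hsub : withEnds G U ⊆ (⋃ x ∈ (X : Set V), {VertexEndSpace.vert x}) ∪
        ⋃ C ∈ {C : G.ComponentCompl (X : Set V) | Meets C U}, componentBox C := by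
      intro p hp
      rcases exists_mem_componentBox hp X with ⟨x, hx, rfl⟩ | ⟨C, hC, hpC⟩
      · exact Or.inl (Set.mem_biUnion (by exact hx) rfl)
      · exact Or.inr (Set.mem_biUnion (by exact hC) hpC)
    rcases Ultrafilter.union_mem_iff.1 (Filter.mem_of_superset hF hsub) with h | h
    · obtain ⟨x, -, hx⟩ := (Ultrafilter.finite_biUnion_mem_iff X.finite_toSet).1 h
      exact (hne x hx).elim
    · obtain ⟨C, hC, hCF⟩ := (Ultrafilter.finite_biUnion_mem_iff (hU X)).1 h
      exact ⟨C, hCF, hC⟩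
  choose f hfF hfU using h
  refine ⟨⟨f, fun X Y hXY v hv => ?_⟩, fun X => ⟨hfF X, hfU X⟩⟩
  obtain ⟨p, hpX, hpY⟩ := F.nonempty_of_mem (Filter.inter_mem (hfF X) (hfF Y))
  have hom : (f Y).hom (Finset.coe_subset.2 hXY) = f X := by
    cases p with
    | vert w =>
      exact component_eq_of_mem (ComponentCompl.subset_hom _ _ (vert_mem_componentBox.1 hpY))
        (vert_mem_componentBox.1 hpX)
    | ofEnd ω => rw [← ofEnd_mem_componentBox.1 hpX, ← ofEnd_mem_componentBox.1 hpY, ω.hom_comp hXY]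
  rw [← hom]
  exact ComponentCompl.subset_hom _ _ hv

/-- The star–comb lemma for tough sets, where it always provides a comb. -/
theorem Tough.exists_comb {L : Set V} (hL : Tough G L) (hinf : L.Infinite) :
    ∃ K : Comb G, K.teeth ⊆ L := by
  have := hinf.cofinite_inf_principal_neBot
  let F := Ultrafilter.of (Filter.cofinite ⊓ Filter.principal L)
  have hF : (F : Filter V) ≤ Filter.cofinite ⊓ Filter.principal L := Ultrafilter.of_le _
  obtain ⟨f, hf⟩ := hL.exists_direction (F.map VertexEndSpace.vert) (by
      rw [Ultrafilter.mem_map]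
      filter_upwards [hF.trans inf_le_right (Filter.mem_principal_self L)] with v hv
      exact Or.inl ⟨v, hv, rfl⟩) (fun v hv => by
      rw [Ultrafilter.mem_map] at hv
      have h₁ : ({v}ᶜ : Set V) ∈ F := hF.trans inf_le_left (Set.finite_singleton v).compl_mem_cofinite
      obtain ⟨w, hw, hwv⟩ := F.nonempty_of_mem (Filter.inter_mem hv h₁)
      refine hwv ?_
      injection hw)
  exact f.exists_comb fun X => (hf X).2

theorem Tough.isCompact_withEnds {U : Set V} (hU : Tough G U) : IsCompact (withEnds G U) := by
  rw [isCompact_iff_ultrafilter_le_nhds]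
  intro F hF
  have hF : withEnds G U ∈ F := Filter.le_principal_iff.1 hF
  by_cases hne : ∀ v, {VertexEndSpace.vert v} ∉ F
  · obtain ⟨f, hf⟩ := hU.exists_direction F hF hne
    obtain ⟨ω, hω⟩ := f.exists_end
    refine ⟨VertexEndSpace.ofEnd ω, Or.inr ⟨ω, fun X => ?_, rfl⟩, fun s hs => ?_⟩
    · rw [hω]
      exact (hf X).2
    · obtain ⟨t, hts, ht, hωt⟩ := mem_nhds_iff.1 hs
      obtain ⟨X, hX⟩ := ht ω hωt
      refine Filter.mem_of_superset (hf X).1 (subset_trans ?_ hts)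
      rw [← hω]
      exact hX
  · push Not at hne
    obtain ⟨v, hv⟩ := hne
    obtain ⟨p, rfl, hp⟩ := F.nonempty_of_mem (Filter.inter_mem hv hF)
    exact ⟨_, hp, fun s hs => Filter.mem_of_superset hv
      (Set.singleton_subset_iff.2 (mem_of_mem_nhds hs))⟩

theorem Ends.exists_comp_ne {ω η : Ends G} (h : ω ≠ η) : ∃ X : Finset V, ω.comp X ≠ η.comp X := by
  by_contra! hX
  refine h ?_
  induction ω using Quotient.inductionOn with
  | h R =>
    induction η using Quotient.inductionOn with
    | h S =>
      refine Quotient.sound fun X => ⟨_, Ends.comp_spec R X, ?_⟩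
      rw [hX]
      exact Ends.comp_spec S X

theorem disjoint_componentBox {X : Finset V} {C D : G.ComponentCompl (X : Set V)} (h : C ≠ D) :
    Disjoint (componentBox C) (componentBox D) := by
  rw [Set.disjoint_left]
  rintro (v | ω) hC hD
  · exact h (component_eq_of_mem (vert_mem_componentBox.1 hC) (vert_mem_componentBox.1 hD))
  · exact h ((ofEnd_mem_componentBox.1 hC).symm.trans (ofEnd_mem_componentBox.1 hD))

instance vertexEndSpace_t2Space : T2Space (VertexEndSpace G) := by
  have hve : ∀ (v : V) (ω : Ends G), Disjoint {VertexEndSpace.vert v}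
      (componentBox (ω.comp {v})) := by
    intro v ω
    rw [Set.disjoint_singleton_left, vert_mem_componentBox]
    exact fun h => ComponentCompl.notMem_of_mem h (by simp)
  refine ⟨?_⟩
  rintro (v | ω) (w | η) h
  · exact ⟨_, _, isOpen_singleton_vert v, isOpen_singleton_vert w, rfl, rfl, by simpa using h⟩
  · exact ⟨_, _, isOpen_singleton_vert v, isOpen_componentBox (η.comp {v}), rfl,
      ofEnd_mem_componentBox.2 rfl, hve v η⟩
  · exact ⟨_, _, isOpen_componentBox (ω.comp {w}), isOpen_singleton_vert w,
      ofEnd_mem_componentBox.2 rfl, rfl, (hve w ω).symm⟩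
  · obtain ⟨X, hX⟩ := Ends.exists_comp_ne (ω := ω) (η := η) fun h' => h (by rw [h'])
    exact ⟨_, _, isOpen_componentBox (ω.comp X), isOpen_componentBox (η.comp X),
      ofEnd_mem_componentBox.2 rfl, ofEnd_mem_componentBox.2 rfl, disjoint_componentBox hX⟩

theorem withEnds_subset_closure (U : Set V) :
    withEnds G U ⊆ closure (VertexEndSpace.vert '' U) := by
  rintro _ (⟨v, hv, rfl⟩ | ⟨ω, hω, rfl⟩)
  · exact subset_closure ⟨v, hv, rfl⟩
  · rw [mem_closure_iff]
    intro s hs hωs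
    obtain ⟨X, hX⟩ := hs ω hωs
    obtain ⟨v, hv, hvU⟩ := hω X
    exact ⟨_, hX (Or.inl ⟨v, hv, rfl⟩), v, hvU, rfl⟩

/-- The components of `G - X` and the vertices of `X` yield a cover by disjoint open sets, so a
finite subcover contains every component that meets `U`. -/
theorem Tough.of_isCompact {U : Set V} (h : IsCompact (withEnds G U)) : Tough G U := by
  classical
  intro X
  obtain ⟨t, ht⟩ := h.elim_finite_subcover
    (fun i : {x // x ∈ X} ⊕ G.ComponentCompl (X : Set V) =>
      Sum.elim (fun x : {x // x ∈ X} => {VertexEndSpace.vert (x : V)})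
        (fun C : G.ComponentCompl (X : Set V) => componentBox C) i)
    (by rintro (x | C); exacts [isOpen_singleton_vert _, isOpen_componentBox C])
    (by
      intro p hp
      rcases exists_mem_componentBox hp X with ⟨x, hx, rfl⟩ | ⟨C, -, hpC⟩
      · exact Set.mem_iUnion.2 ⟨Sum.inl ⟨x, hx⟩, rfl⟩
      · exact Set.mem_iUnion.2 ⟨Sum.inr C, hpC⟩)
  refine (t.finite_toSet.preimage Sum.inr_injective.injOn).subset ?_
  rintro C ⟨u, huC, huU⟩
  obtain ⟨i, hi, hui⟩ := Set.mem_iUnion₂.1 (ht (Or.inl ⟨u, huU, rfl⟩))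
  rcases i with x | D
  · have hux : u = x := by injection hui
    exact (ComponentCompl.notMem_of_mem huC (hux ▸ x.2)).elim
  · rw [component_eq_of_mem huC (vert_mem_componentBox.1 hui)]
    exact hi

theorem compactifiedByEnds_iff_tough (U : Set V) : CompactifiedByEnds G U ↔ Tough G U :=
  ⟨fun h => .of_isCompact h.1,
    fun h => ⟨h.isCompact_withEnds, inferInstance, withEnds_subset_closure U⟩⟩

/-! ### Critical sets and undominating stars -/

theorem HasUndominatingStar.not_tough {U : Set V} (h : HasUndominatingStar G U) :
    ¬ Tough G U := by
  obtain ⟨S, hSU, hS⟩ := h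
  intro hU
  obtain ⟨K, hK⟩ := (hU.subset hSU).exists_comb S.leaves_infinite
  refine hS ⟨K, ?_⟩
  rw [SubdividedStar.Dominates, Set.inter_eq_right.2 hK]
  exact K.teeth_infinite

/-- A component of `G - X` whose neighbourhood is `Y ⊆ X` is also a component of `G - Y`. -/
theorem exists_component_eq {X Y : Finset V} (hYX : Y ⊆ X) {C : G.ComponentCompl (X : Set V)}
    (hC : neighbourhood G (C : Set V) = Y) :
    ∃ D : G.ComponentCompl (Y : Set V), (D : Set V) = C := by
  obtain ⟨c, hc⟩ := C.nonempty
  have hcY : c ∉ (Y : Set V) := fun h => ComponentCompl.notMem_of_mem hc (hYX h)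
  refine ⟨G.componentComplMk hcY, Set.ext fun v => ⟨fun hv => ?_, fun hv => ?_⟩⟩
  · obtain ⟨w, -, hw⟩ := exists_walk_in_component (G.componentComplMk_mem hcY) hv
    by_contra hvC
    obtain ⟨d, hd, hd₁, hd₂⟩ := w.exists_boundary_dart (C : Set V) hc hvC
    refine ComponentCompl.notMem_of_mem (hw _ (w.dart_snd_mem_support_of_mem_darts hd)) ?_
    rw [← hC]
    exact ⟨hd₂, _, hd₁, d.adj.symm⟩
  · obtain ⟨w, -, hw⟩ := exists_walk_in_component hc hv
    exact mem_component_of_walk w (G.componentComplMk_mem hcY)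
      (fun z hz h => ComponentCompl.notMem_of_mem (hw z hz) (hYX h)) v w.end_mem_support

theorem neighbourhood_component_subset {X : Set V} (C : G.ComponentCompl X) :
    neighbourhood G (C : Set V) ⊆ X := by
  rintro v ⟨hv, w, hw, hvw⟩
  by_contra hX
  exact hv (ComponentCompl.mem_of_adj _ _ hw hX hvw.symm)

/-- By the pigeonhole principle, infinitely many of the components of `G - X` that meet `U` have
the same neighbourhood, which is then critical. -/
theorem exists_criticalInClosure {U : Set V} (h : ¬ Tough G U) :
    ∃ X : Finset V, CriticalInClosure G X U := by
  classical
  obtain ⟨X, hX⟩ := not_forall.1 h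
  obtain ⟨Y, hYX, hY⟩ : ∃ Y ⊆ X, {C : G.ComponentCompl (X : Set V) |
      Meets C U ∧ neighbourhood G (C : Set V) = Y}.Infinite := by
    by_contra! hfin
    refine hX ((X.powerset.finite_toSet.biUnion (t := fun Y => {C : G.ComponentCompl (X : Set V) |
      Meets C U ∧ neighbourhood G (C : Set V) = Y}) fun Y hY => ?_).subset fun C hC => ?_)
    · exact hfin Y (Finset.mem_powerset.1 hY)
    · have hN := neighbourhood_component_subset C
      have hNfin := X.finite_toSet.subset hN
      refine Set.mem_biUnion (x := hNfin.toFinset) ?_ ⟨hC, by simp⟩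
      simpa [Finset.subset_iff] using hN
  have : Nonempty (G.ComponentCompl (Y : Set V)) :=
    let ⟨_, hC⟩ := hY.nonempty
    ⟨(exists_component_eq hYX hC.2).choose⟩
  choose! D hD using fun (C : G.ComponentCompl (X : Set V))
    (hC : neighbourhood G (C : Set V) = Y) => exists_component_eq hYX hC
  have hinf : {C ∈ fullComponents G (Y : Set V) | Meets C U}.Infinite := by
    refine (hY.image (f := D) ?_).mono ?_
    · intro C hC C' hC' hCC'
      rw [← ComponentCompl.coe_inj, ← hD C hC.2, ← hD C' hC'.2, hCC']
    · rintro _ ⟨C, hC, rfl⟩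
      constructor
      · change neighbourhood G _ = _
        rw [hD C hC.2, hC.2]
      · rw [Meets, hD C hC.2]
        exact hC.1
  exact ⟨Y, hinf.mono fun _ h => h.1, hinf⟩

/-- Each component `C` with neighbourhood `X` contributes a path to `U` through `C` that starts
in a fixed vertex of `X`. A comb cannot have infinitely many of the leaves as teeth, since its
spine has a tail in a single component. -/
theorem CriticalInClosure.hasUndominatingStar (hG : G.Connected) {X : Finset V} {U : Set V}
    (h : CriticalInClosure G X U) : HasUndominatingStar G U := by
  classical
  have hX : (X : Set V).Nonempty := by
    rw [Set.nonempty_iff_ne_empty]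
    intro h0
    obtain ⟨C, -, D, -, hCD⟩ := h.2.nontrivial
    obtain ⟨c, hc⟩ := C.nonempty
    obtain ⟨d, hd⟩ := D.nonempty
    obtain ⟨w⟩ := hG.preconnected c d
    exact hCD (component_eq_of_mem
      (mem_component_of_walk w hc (by simp [h0]) d w.end_mem_support) hd)
  obtain ⟨x, hx⟩ := hX
  have hpath : ∀ C : {C ∈ fullComponents G (X : Set V) | Meets C U}, ∃ u ∈ U, u ∈ C.1 ∧
      ∃ p : G.Path x u, ∀ v ∈ (p : G.Walk x u).support, v = x ∨ v ∈ C.1 := by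
    rintro ⟨C, hCX, u, huC, huU⟩
    obtain ⟨hxC, w, hw, hxw⟩ : x ∈ neighbourhood G (C : Set V) := by
      rw [show neighbourhood G (C : Set V) = X from hCX]
      exact hx
    obtain ⟨p, hp, hpC⟩ := exists_walk_in_component (C := C) hw huC
    refine ⟨u, huU, huC, ⟨Walk.cons hxw p, hp.cons fun h => hxC (hpC x h)⟩, fun v hv => ?_⟩
    rcases List.mem_cons.1 (by simpa using hv) with rfl | hv
    · exact Or.inl rfl
    · exact Or.inr (hpC v hv)
  choose u huU huC p hp using hpath
  have huinj : Function.Injective u := fun C D h =>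
    Subtype.ext (component_eq_of_mem (huC C) (h ▸ huC D))
  have := h.2.to_subtype
  let idx : Set.range u → {C ∈ fullComponents G (X : Set V) | Meets C U} := fun l => l.2.choose
  have hidx : ∀ l, u (idx l) = l := fun l => l.2.choose_spec
  refine ⟨{
    centre := x
    leaves := Set.range u
    leaves_infinite := Set.infinite_range_of_injective huinj
    centre_notMem := ?_
    path := fun l => ⟨(p (idx l) : G.Walk x _).copy rfl (hidx l), by simp⟩
    meet := ?_ }, ?_, ?_⟩
  · rintro ⟨C, hC⟩
    exact ComponentCompl.notMem_of_mem (huC C) (hC ▸ hx)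
  · intro l m hlm v hl hm
    simp only [Walk.support_copy] at hl hm
    rcases hp _ v hl with h | hl
    · exact h
    rcases hp _ v hm with h | hm
    · exact h
    refine (hlm (Subtype.ext ?_)).elim
    rw [← hidx l, ← hidx m, Subtype.ext (component_eq_of_mem hl hm)]
  · rintro _ ⟨C, rfl⟩
    exact huU C
  · rintro ⟨K, hK⟩
    obtain ⟨D, hD⟩ := K.spine.exists_tailIn X
    refine hK (((K.finite_teeth_notMem hD).union (Set.Subsingleton.finite
      (s := Set.range u ∩ D) ?_)).subset ?_)
    · rintro _ ⟨⟨C, rfl⟩, hC⟩ _ ⟨⟨C', rfl⟩, hC'⟩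
      rw [Subtype.ext ((component_eq_of_mem (huC C) hC).trans (component_eq_of_mem hC' (huC C')))]
    · rintro t ⟨ht, htK⟩
      by_cases htD : t ∈ (D : Set V)
      · exact Or.inr ⟨ht, htD⟩
      · exact Or.inl ⟨htK, htD⟩

/-! ### The tree-order -/

namespace RootedTree

variable (T : RootedTree G)

theorem exists_path (y : T.T.verts) : ∃ p : T.T.coe.Walk T.root y, p.IsPath :=
  let ⟨p, hp, _⟩ := T.isTree.existsUnique_path T.root y
  ⟨p, hp⟩

variable {T}

theorem le_iff_mem_support {x y : T.T.verts} {p : T.T.coe.Walk T.root y} (hp : p.IsPath) :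
    T.le x y ↔ x ∈ p.support := by
  refine ⟨fun ⟨q, hq⟩ => ?_, fun h => ⟨⟨p, hp⟩, h⟩⟩
  rwa [(T.isTree.existsUnique_path T.root y).unique hp q.2]

theorem le_refl (x : T.T.verts) : T.le x x :=
  let ⟨p, hp⟩ := T.exists_path x
  ⟨⟨p, hp⟩, p.end_mem_support⟩

theorem root_le (x : T.T.verts) : T.le T.root x :=
  let ⟨p, hp⟩ := T.exists_path x
  ⟨⟨p, hp⟩, p.start_mem_support⟩

theorem le_trans {x y z : T.T.verts} (hxy : T.le x y) (hyz : T.le y z) : T.le x z := by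
  classical
  obtain ⟨q, hq⟩ := hyz
  rw [le_iff_mem_support (q.2.takeUntil hq)] at hxy
  exact ⟨q, Walk.support_takeUntil_subset_support _ hq hxy⟩

theorem le_total_of_le {x y z : T.T.verts} (hx : T.le x z) (hy : T.le y z) :
    T.le x y ∨ T.le y x := by
  classical
  obtain ⟨⟨p, hp⟩, hy⟩ := hy
  rw [le_iff_mem_support hp, ← p.take_spec hy, Walk.mem_support_append_iff] at hx
  rcases hx with hx | hx
  · exact Or.inl ⟨⟨_, hp.takeUntil hy⟩, hx⟩
  · refine Or.inr ⟨⟨(p.takeUntil y hy).append ((p.dropUntil y hy).takeUntil x hx), ?_⟩, ?_⟩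
    · have h := hp
      rw [← p.take_spec hy, ← (p.dropUntil y hy).take_spec hx, Walk.append_assoc] at h
      exact h.of_append_left
    · rw [Walk.mem_support_append_iff]
      exact Or.inl (Walk.end_mem_support _)

theorem finite_setOf_le (y : T.T.verts) : {x | T.le x y}.Finite := by
  obtain ⟨p, hp⟩ := T.exists_path y
  simp_rw [le_iff_mem_support hp]
  exact p.support.finite_toSet

/-- A neighbour of `v` that is not below `v` is a child of `v`. -/
theorem le_child_iff {v w z : T.T.verts} (hvw : T.T.coe.Adj v w) (hw : ¬ T.le w v) :
    T.le z w ↔ T.le z v ∨ z = w := by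
  obtain ⟨p, hp⟩ := T.exists_path v
  rw [le_iff_mem_support hp] at hw ⊢
  rw [le_iff_mem_support (hp.concat hw hvw)]
  simp [Walk.support_concat]

/-- In the definition of a normal tree, the `T`-paths may be replaced by walks. -/
theorem IsNormal.le_or_le_of_walk (hT : T.IsNormal) {x : T.T.verts} {a : V} (q : G.Walk (x : V) a)
    (hq : ∀ v ∈ q.support, v ∈ T.T.verts → v = x ∨ v = a) (ha : a ∈ T.T.verts) :
    T.le x ⟨a, ha⟩ ∨ T.le ⟨a, ha⟩ x := by
  classical
  by_cases hxa : x = ⟨a, ha⟩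
  · rw [← hxa]
    exact Or.inl (le_refl x)
  · exact hT x ⟨a, ha⟩ hxa ⟨q.bypass, q.bypass_isPath⟩ fun v hv =>
      hq v (q.support_bypass_subset_support hv)

/-- The separation property of normal trees, for a walk from `x` that is split at a vertex `a`. The
first part `q` has no inner vertex in `T`, and the induction on the second part moves `a` along the
walk, so that `x` is always the last vertex of `T` before `a`. -/
theorem IsNormal.exists_le_of_append (hT : T.IsNormal) {a : V} {y : T.T.verts} (w : G.Walk a y)
    {x : T.T.verts} (q : G.Walk (x : V) a) (hq : ∀ v ∈ q.support, v ∈ T.T.verts → v = x ∨ v = a) :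
    ∃ t : T.T.verts, ((t : V) = x ∨ (t : V) ∈ w.support) ∧ T.le t x ∧ T.le t y := by
  obtain ⟨y, hy⟩ := y
  dsimp only at w
  induction w generalizing x with
  | nil =>
    rcases hT.le_or_le_of_walk q hq hy with h | h
    · exact ⟨x, Or.inl rfl, le_refl x, h⟩
    · exact ⟨_, Or.inr (Walk.end_mem_support _), h, le_refl _⟩
  | @cons a b c hab w ih =>
    by_cases ha : a ∈ T.T.verts
    · obtain ⟨t, htw, hta, hty⟩ := ih (x := ⟨a, ha⟩) (Walk.cons hab Walk.nil) (by simp) hy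
      have htw : (t : V) ∈ (Walk.cons hab w).support := by simpa using htw
      rcases hT.le_or_le_of_walk q hq ha with h | h
      · rcases le_total_of_le h hta with h' | h'
        · exact ⟨x, Or.inl rfl, le_refl x, le_trans h' hty⟩
        · exact ⟨t, Or.inr htw, h', hty⟩
      · exact ⟨t, Or.inr htw, le_trans hta h, hty⟩
    · obtain ⟨t, htw, htx, hty⟩ := ih (q.concat hab) (by
        intro v hv hvT
        have hv : v ∈ q.support ∨ v = b := by simpa [Walk.support_concat] using hv
        rcases hv with hv | rfl
        · rcases hq v hv hvT with h | rfl
          · exact Or.inl h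
          · exact (ha hvT).elim
        · exact Or.inr rfl) hy
      refine ⟨t, htw.imp_right fun h => ?_, htx, hty⟩
      simp [h]

/-- Any two vertices `x`, `y` of a normal tree are separated in `G` by the set of vertices below
both. -/
theorem IsNormal.exists_le_mem_support (hT : T.IsNormal) {x y : T.T.verts} (w : G.Walk (x : V) y) :
    ∃ t : T.T.verts, (t : V) ∈ w.support ∧ T.le t x ∧ T.le t y := by
  obtain ⟨t, ht, h⟩ := hT.exists_le_of_append w (x := x) Walk.nil (by simp)
  refine ⟨t, ?_, h⟩
  rcases ht with h | h
  · rw [h]; exact w.start_mem_support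
  · exact h

end RootedTree

/-- A walk in a subgraph `H` with all its vertices in `s` is a walk in the subgraph that `s`
induces in `H`. -/
theorem exists_walk_induce {H : G.Subgraph} {s : Set V} {a b : H.verts} (p : H.coe.Walk a b)
    (hs : ∀ v ∈ p.support, (v : V) ∈ s) (ha : (a : V) ∈ s) (hb : (b : V) ∈ s) :
    ∃ q : (H.induce s).coe.Walk ⟨a, ha⟩ ⟨b, hb⟩,
      q.support.map Subtype.val = p.support.map Subtype.val := by
  induction p with
  | nil => exact ⟨Walk.nil, rfl⟩
  | @cons a c b h p ih =>
    have hc : (c : V) ∈ s := hs c (by simp)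
    obtain ⟨q, hq⟩ := ih (fun v hv => hs v (by simp [hv])) hc hb
    have hadj : (H.induce s).coe.Adj ⟨a, ha⟩ ⟨c, hc⟩ := ⟨ha, hc, h⟩
    refine ⟨Walk.cons hadj q, ?_⟩
    rw [Walk.support_cons, Walk.support_cons, List.map_cons, List.map_cons, hq]

/-! ### Down-closures in a tree -/

namespace RootedTree

/-- The vertices of `T` below some element of `U`. -/
def downSet (T : RootedTree G) (U : Set V) : Set V :=
  {v | ∃ (h : v ∈ T.T.verts) (y : T.T.verts), (y : V) ∈ U ∧ T.le ⟨v, h⟩ y}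

variable {T : RootedTree G} {U : Set V}

theorem mem_downSet_of_le {x y : T.T.verts} (h : T.le x y) (hy : (y : V) ∈ T.downSet U) :
    (x : V) ∈ T.downSet U :=
  let ⟨_, z, hz, hyz⟩ := hy
  ⟨x.2, z, hz, le_trans h hyz⟩

/-- A vertex in the down-closure of `U` is joined to the root by a path inside the
down-closure. -/
theorem exists_path_induce_downSet (hroot : (T.root : V) ∈ T.downSet U) (y : T.T.verts)
    (hy : (y : V) ∈ T.downSet U) :
    ∃ q : (T.T.induce (T.downSet U)).coe.Path ⟨T.root, hroot⟩ ⟨y, hy⟩,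
      ∀ x (hx : x ∈ T.T.verts) (hx' : x ∈ T.downSet U), T.le ⟨x, hx⟩ y →
        (⟨x, hx'⟩ : (T.T.induce (T.downSet U)).verts) ∈
          q.1.support := by
  obtain ⟨p, hp⟩ := T.exists_path y
  obtain ⟨q, hq⟩ := exists_walk_induce p
    (fun v hv => mem_downSet_of_le ((le_iff_mem_support hp).2 hv) hy) hroot hy
  refine ⟨⟨q, ?_⟩, fun x hx hx' hxy => ?_⟩
  · rw [Walk.isPath_def]
    refine List.Nodup.of_map Subtype.val ?_
    rw [hq]
    exact hp.support_nodup.map Subtype.val_injective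
  · rw [le_iff_mem_support hp] at hxy
    have : x ∈ q.support.map Subtype.val := by
      rw [hq]
      exact List.mem_map_of_mem hxy
    obtain ⟨z, hz, rfl⟩ := List.mem_map.1 this
    exact hz

/-- The subtree of `T` on the down-closure of a set `U` that meets `T`. -/
def downTree (T : RootedTree G) (U : Set V) (hroot : (T.root : V) ∈ T.downSet U) :
    RootedTree G where
  T := T.T.induce (T.downSet U)
  isTree := by
    have hle : T.T.induce (T.downSet U) ≤ T.T := ⟨fun v hv => hv.1, fun _ _ h => h.2.2⟩
    refine ⟨?_, T.isTree.isAcyclic.comap (Subgraph.inclusion hle)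
      (Subgraph.inclusion.injective hle)⟩
    rw [connected_iff_exists_forall_reachable]
    refine ⟨⟨T.root, hroot⟩, fun ⟨y, hy⟩ => ?_⟩
    obtain ⟨q, -⟩ := exists_path_induce_downSet hroot ⟨y, hy.1⟩ hy
    exact ⟨q⟩
  root := ⟨T.root, hroot⟩

theorem downTree_le (hroot : (T.root : V) ∈ T.downSet U) {x y : T.T.verts}
    (hx : (x : V) ∈ T.downSet U) (hy : (y : V) ∈ T.downSet U) (h : T.le x y) :
    (T.downTree U hroot).le ⟨x, hx⟩ ⟨y, hy⟩ := by
  obtain ⟨q, hq⟩ := exists_path_induce_downSet hroot y hy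
  exact ⟨q, hq x x.2 hx h⟩

theorem IsNormal.downTree (hT : T.IsNormal) (hroot : (T.root : V) ∈ T.downSet U) :
    (T.downTree U hroot).IsNormal := by
  rintro ⟨x, hx⟩ ⟨y, hy⟩ - p hp
  obtain ⟨t, htp, htx, hty⟩ := hT.exists_le_mem_support (x := ⟨x, hx.1⟩) (y := ⟨y, hy.1⟩) p.1
  rcases hp t htp (mem_downSet_of_le htx hx) with h | h
  · obtain rfl : t = ⟨x, hx.1⟩ := Subtype.ext h
    exact Or.inl (downTree_le hroot (x := ⟨x, hx.1⟩) (y := ⟨y, hy.1⟩) hx hy hty)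
  · obtain rfl : t = ⟨y, hy.1⟩ := Subtype.ext h
    exact Or.inr (downTree_le hroot (x := ⟨y, hy.1⟩) (y := ⟨x, hx.1⟩) hy hx htx)

theorem downTree_containsCofinally (hU : U ⊆ T.T.verts) (hroot : (T.root : V) ∈ T.downSet U) :
    (T.downTree U hroot).ContainsCofinally U := by
  have hUd : U ⊆ T.downSet U := fun u hu => ⟨hU hu, ⟨u, hU hu⟩, hu, le_refl _⟩
  refine ⟨hUd, ?_⟩
  rintro ⟨x, hx, y, hy, hxy⟩
  exact ⟨⟨y, hUd hy⟩, hy, downTree_le hroot (x := ⟨x, hx⟩) _ _ hxy⟩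

/-- If `v` had infinitely many children in the down-closure of `U`, then elements of `U` above
different children would lie in different components of `G - X`, where `X` is the finite set of
vertices below `v`. -/
theorem downTree_isLocallyFinite (hT : T.IsNormal) (hU : Tough G U)
    (hroot : (T.root : V) ∈ T.downSet U) : (T.downTree U hroot).IsLocallyFinite := by
  classical
  rintro v ⟨hv, -⟩
  have hfin := (finite_setOf_le (⟨v, hv⟩ : T.T.verts)).image Subtype.val
  let X : Finset V := hfin.toFinset
  have hX : ∀ {z : T.T.verts}, (z : V) ∈ (X : Set V) ↔ T.le z ⟨v, hv⟩ := by
    intro z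
    simp [X]
  let W : Set V := (T.downTree U hroot).T.neighborSet v \ X
  suffices hW : W.Finite by
    refine (hW.union X.finite_toSet).subset fun w hw => ?_
    by_cases hwX : w ∈ (X : Set V)
    · exact Or.inr hwX
    · exact Or.inl ⟨hw, hwX⟩
  have hchild : ∀ w : W, ∃ (hw : (w : V) ∈ T.T.verts) (u : T.T.verts), (u : V) ∈ U ∧
      T.le ⟨w, hw⟩ u ∧ T.T.coe.Adj ⟨v, hv⟩ ⟨w, hw⟩ ∧ ¬ T.le ⟨w, hw⟩ ⟨v, hv⟩ := by
    rintro ⟨w, ⟨-, ⟨hw, u, hu, hwu⟩, hadj⟩, hwX⟩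
    exact ⟨hw, u, hu, hwu, hadj, fun h => hwX (hX.2 h)⟩
  choose hWT u huU hwu hadj hnle using hchild
  have huX : ∀ w, (u w : V) ∉ (X : Set V) := fun w h =>
    hnle w (le_trans (hwu w) (hX.1 h))
  have := (hU X).to_subtype
  refine Finite.of_injective (β := {C : G.ComponentCompl (X : Set V) | Meets C U}) (fun w =>
    ⟨G.componentComplMk (huX w), u w, G.componentComplMk_mem (huX w), huU w⟩) fun w w' hww' => ?_
  have hC : G.componentComplMk (huX w) = G.componentComplMk (huX w') := congrArg Subtype.val hww'
  obtain ⟨p, -, hp⟩ := exists_walk_in_component (G.componentComplMk_mem (huX w))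
    (hC ▸ G.componentComplMk_mem (huX w'))
  obtain ⟨t, htp, ht, ht'⟩ := hT.exists_le_mem_support p
  have htv : ¬ T.le t ⟨v, hv⟩ := fun h => ComponentCompl.notMem_of_mem (hp t htp) (hX.2 h)
  -- Since `t` is not below `v`, it lies above both children of `v`, which are thus comparable.
  have above : ∀ w, T.le t (u w) → T.le ⟨w, hWT w⟩ t := by
    intro w ht
    rcases le_total_of_le ht (hwu w) with h | h
    · rcases (le_child_iff (hadj w) (hnle w)).1 h with h | rfl
      · exact (htv h).elim
      · exact le_refl _
    · exact h
  rcases le_total_of_le (above w ht) (above w' ht') with h | h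
  · rcases (le_child_iff (hadj w') (hnle w')).1 h with h | h
    · exact (hnle w h).elim
    · exact Subtype.ext (Subtype.mk.inj h)
  · rcases (le_child_iff (hadj w) (hnle w)).1 h with h | h
    · exact (hnle w' h).elim
    · exact (Subtype.ext (Subtype.mk.inj h)).symm

end RootedTree

/-! ### Locally finite normal trees -/

/-- A set of vertices of a locally finite connected subgraph `H` is tough: every component of
`G - X` that meets `H` contains a fixed vertex of `H` or one of the finitely many neighbours in `H`
of vertices in `X`. -/
theorem tough_of_locallyFinite {H : G.Subgraph} (hH : H.coe.Connected)
    (hfin : ∀ v ∈ H.verts, (H.neighborSet v).Finite) {U : Set V} (hU : U ⊆ H.verts) :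
    Tough G U := by
  classical
  intro X
  obtain ⟨r⟩ := hH.nonempty
  have hB : (insert (r : V) (⋃ x ∈ (X : Set V), H.neighborSet x)).Finite := by
    refine (X.finite_toSet.biUnion fun x _ => ?_).insert _
    by_cases hx : x ∈ H.verts
    · exact hfin x hx
    · convert Set.finite_empty
      exact Set.eq_empty_of_forall_notMem fun y hy => hx hy.fst_mem
  have key : ∀ C : G.ComponentCompl (X : Set V), Meets C U →
      ∃ b ∈ insert (r : V) (⋃ x ∈ (X : Set V), H.neighborSet x), b ∈ C := by
    rintro C ⟨u, huC, huU⟩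
    obtain ⟨w⟩ := hH.preconnected ⟨u, hU huU⟩ r
    by_cases hr : (r : V) ∈ C
    · exact ⟨r, Or.inl rfl, hr⟩
    · obtain ⟨d, -, hd₁, hd₂⟩ := w.exists_boundary_dart {z | (z : V) ∈ C} huC hr
      refine ⟨d.fst, Or.inr (Set.mem_biUnion (x := (d.snd : V)) ?_ ?_), hd₁⟩
      · by_contra hX
        exact hd₂ (ComponentCompl.mem_of_adj _ _ hd₁ hX (H.adj_sub d.adj))
      · exact d.adj.symm
  have : Nonempty V := ⟨r⟩
  choose! b hb hbC using key
  refine Set.Finite.of_finite_image (hB.subset ?_) (f := b) ?_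
  · rintro _ ⟨C, hC, rfl⟩
    exact hb C hC
  · intro C hC D hD hCD
    exact component_eq_of_mem (hbC C hC) (hCD ▸ hbC D hD)

theorem exists_normalTree_iff_tough {U : Set V} (hne : U.Nonempty) (hU : NormallySpanned G U) :
    (∃ T : RootedTree G, T.IsNormal ∧ T.IsLocallyFinite ∧ T.ContainsCofinally U) ↔ Tough G U := by
  constructor
  · rintro ⟨T, -, hfin, hTU, -⟩
    exact tough_of_locallyFinite T.isTree.connected hfin hTU
  · intro htough
    obtain ⟨T, hT, hTU⟩ := hU
    obtain ⟨u, hu⟩ := hne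
    have hroot : (T.root : V) ∈ T.downSet U :=
      ⟨T.root.2, ⟨u, hTU hu⟩, hu, RootedTree.root_le _⟩
    exact ⟨T.downTree U hroot, hT.downTree hroot, RootedTree.downTree_isLocallyFinite hT htough hroot,
      RootedTree.downTree_containsCofinally hTU hroot⟩

end StarComb

theorem lemma2p3 {V : Type*} (G : SimpleGraph V) (hG : G.Connected) (U : Set V) :
    (StarComb.HasUndominatingStar G U ↔ ¬ StarComb.Tough G U) ∧
    (StarComb.HasUndominatingStar G U ↔
      ¬ ¬ ∃ X : Finset V, StarComb.CriticalInClosure G X U) ∧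
    (StarComb.HasUndominatingStar G U ↔ ¬ StarComb.CompactifiedByEnds G U) ∧
    (U.Nonempty → StarComb.NormallySpanned G U →
      (StarComb.HasUndominatingStar G U ↔
        ¬ ∃ T : StarComb.RootedTree G,
          T.IsNormal ∧ T.IsLocallyFinite ∧ T.ContainsCofinally U)) := by
  have hcrit : (∃ X : Finset V, StarComb.CriticalInClosure G X U) →
      StarComb.HasUndominatingStar G U := fun ⟨_, hX⟩ => hX.hasUndominatingStar hG
  have htough : StarComb.HasUndominatingStar G U ↔ ¬ StarComb.Tough G U :=
    ⟨fun h => h.not_tough, fun h => hcrit (StarComb.exists_criticalInClosure h)⟩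
  refine ⟨htough, ?_, ?_, fun hne hU => ?_⟩
  · rw [not_not]
    exact ⟨fun h => StarComb.exists_criticalInClosure h.not_tough, hcrit⟩
  · rwa [StarComb.compactifiedByEnds_iff_tough]
  · rwa [StarComb.exists_normalTree_iff_tough hne hU]
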